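/- Let $N>0$ be real and let $L\ge 2$ be an integer. For $n\ge 1$, a set $\mathcal C\subseteq\mathbb R^n$ is an $(N,L-1)$-multiple packing if every closed Euclidean ball of radius $\sqrt{nN}$ in $\mathbb R^n$ contains at most $L-1$ points of $\mathcal C$. For each $n$ let $\mathcal A_n\subset\mathbb R^n$ be an arbitrary centrally symmetric ($\mathcal A_n=-\mathcal A_n$), connected, compact set with nonempty interior (for example the closed unit ball or the cube $[-1,1]^n$), and define the rate of $\mathcal C\subseteq\mathbb R^n$ by $$R(\mathcal C)=\limsup_{K\to\infty}\frac1n\ln\frac{|\mathcal C\cap K\mathcal A_n|}{\operatorname{vol}(K\mathcal A_n)}\in[-\infty,+\infty],\qquad \ln 0=-\infty,$$ where $|\cdot|$ is the number of points and $\operatorname{vol}$ is Lebesgue measure. Let $$C_{L-1}(N)=\limsup_{n\to\infty}\ \sup\{R(\mathcal C):\ \mathcal C\subseteq\mathbb R^n\text{ is an }(N,L-1)\text{-multiple packing}\}$$ be the $(N,L-1)$-list-decoding capacity (multiple packing density). Then, for every choice of the sets $\mathcal A_n$, $$C_{L-1}(N)\le\frac12\ln\frac{L-1}{L\cdot 2\pi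 e N}.$$ -/

import Mathlib

open MeasureTheory Filter
open scoped Pointwise ENNReal

/-- `C ⊆ ℝⁿ` is an `(N, L-1)`-multiple packing (an `(N, L-1)`-list-decodable code): every closed
Euclidean ball of radius `√(nN)` contains at most `L - 1` points of `C`. -/
def IsMultiplePacking {n : ℕ} (N : ℝ) (L : ℕ) (C : Set (EuclideanSpace ℝ (Fin n))) : Prop :=
  ∀ y : EuclideanSpace ℝ (Fin n),
    (C ∩ Metric.closedBall y (Real.sqrt (n * N))).encard ≤ ((L - 1 : ℕ) : ℕ∞)

/-- The admissible sets `A` whose dilates `K • A` are used as observation windows: centrally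
symmetric, connected, compact, with nonempty interior. -/
structure IsWindow {n : ℕ} (A : Set (EuclideanSpace ℝ (Fin n))) : Prop where
  symm : ∀ x ∈ A, -x ∈ A
  connected : IsConnected A
  compact : IsCompact A
  interior_nonempty : (interior A).Nonempty

/-- The rate (normalized logarithmic density) of `C ⊆ ℝⁿ` measured with the window `A`:
`limsup_{K → ∞} (1/n) ln (|C ∩ K A| / |K A|)`, as an extended real number (`ln 0 = -∞`). -/
noncomputable def packingRate {n : ℕ} (A C : Set (EuclideanSpace ℝ (Fin n))) : EReal :=
  limsup (fun K : ℝ =>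
    ENNReal.log (((C ∩ K • A).encard : ℝ≥0∞) / volume (K • A)) / (n : EReal)) atTop

/-- The `(N, L-1)`-list-decoding capacity (multiple packing density)
`C_{L-1}(N) = limsup_{n → ∞} sup_C R(C)`, where `C` ranges over the `(N, L-1)`-multiple packings
in `ℝⁿ` and rates in `ℝⁿ` are measured with the window `A n`. -/
noncomputable def listDecodingCapacity
    (A : ∀ n : ℕ, Set (EuclideanSpace ℝ (Fin n))) (N : ℝ) (L : ℕ) : EReal :=
  limsup (fun n : ℕ =>
    ⨆ C : Set (EuclideanSpace ℝ (Fin n)), ⨆ _ : IsMultiplePacking N L C,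
      packingRate (A n) C) atTop

/-!
Fix `N' < N L / (L - 1)`. Among many points of a ball of radius `√(n N')`, Ramsey's theorem finds a
large subset whose pairwise squared distances nearly coincide, and Plotkin's double counting shows
that their common value is at most about `2 n N'`. Any `L` points of the subset form a nearly
regular simplex of squared circumradius at most about `n N' (L - 1) / L < n N`, which no
`(N, L - 1)`-multiple packing can contain. Neither step sees the dimension, so a packing has at most
`M - 1` points in every ball of radius `√(n N')`, for some `M` independent of `n`. Counting volumes
in a large window bounds its density by `M - 1` over the volume of such a ball, whose exponential
growth rate is `½ ln (2 π e N')` by Stirling's formula. Now let `N'` tend to `N L / (L - 1)`.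
-/

section Ramsey

open Finset

theorem exists_le_card_forall_labelGraph_adj {V κ : Type*} [Fintype κ] [Nonempty κ]
    (C : SimpleGraph.TopEdgeLabeling V κ) (r : κ → ℕ) {x : V} {S : Finset V}
    (hx : x ∉ S) (hS : ∑ a, r a ≤ #S) :
    ∃ a, ∃ T ⊆ S, r a ≤ #T ∧ ∀ y ∈ T, (C.labelGraph a).Adj x y := by
  classical
  have hcover : S ⊆ univ.biUnion fun a ↦ {y ∈ S | (C.labelGraph a).Adj x y} := fun y hy ↦ by
    have hxy : x ≠ y := fun h ↦ hx (h ▸ hy)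
    simpa [hy, SimpleGraph.EdgeLabeling.labelGraph_adj] using hxy
  obtain ⟨a, -, ha⟩ := exists_le_of_sum_le univ_nonempty
    (hS.trans <| (card_le_card hcover).trans card_biUnion_le)
  exact ⟨a, _, filter_subset _ _, ha, fun y hy ↦ (mem_filter.mp hy).2⟩

theorem exists_ramsey_isNClique_labelGraph {κ : Type*} [Finite κ] [Nonempty κ] (m : κ → ℕ) :
    ∃ R : ℕ, ∀ {V : Type*} (C : SimpleGraph.TopEdgeLabeling V κ) (S : Finset V), R ≤ #S →
      ∃ a, ∃ T ⊆ S, (C.labelGraph a).IsNClique (m a) T := by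
  classical
  have := Fintype.ofFinite κ
  induction h : ∑ a, m a using Nat.strong_induction_on generalizing m with | _ s ih =>
  subst h
  by_cases hm : ∃ a, m a = 0
  · obtain ⟨a, ha⟩ := hm
    exact ⟨0, fun _ _ _ ↦ ⟨a, ∅, by simp, by simp [ha]⟩⟩
  push Not at hm
  have hlt (a : κ) : ∑ b, Function.update m a (m a - 1) b < ∑ b, m b :=
    sum_lt_sum (fun b _ ↦ by grind) ⟨a, mem_univ a, by grind⟩
  choose r hr using fun a ↦ ih _ (hlt a) _ rfl
  refine ⟨∑ a, r a + 1, fun C S hS ↦ ?_⟩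
  obtain ⟨x, hx⟩ := card_pos.mp (by lia : 0 < #S)
  obtain ⟨a, U, hUS, hU, hadj⟩ :=
    exists_le_card_forall_labelGraph_adj C r (notMem_erase x S) (by rw [card_erase_of_mem hx]; lia)
  obtain ⟨b, T, hTU, hT⟩ := hr a C U hU
  have hTS : T ⊆ S := (hTU.trans hUS).trans (erase_subset x S)
  by_cases hba : b = a
  · subst hba
    rw [Function.update_self] at hT
    refine ⟨b, insert x T, insert_subset hx hTS, ?_⟩
    simpa [Nat.sub_add_cancel (Nat.pos_of_ne_zero (hm b))]
      using hT.insert fun y hy ↦ hadj y (hTU hy)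
  · exact ⟨b, T, hTS, by rwa [Function.update_of_ne hba] at hT⟩

theorem exists_ramsey_pairwise_mem_Icc (m : ℕ) (B : ℝ) {η : ℝ} (hη : 0 < η) :
    ∃ R : ℕ, ∀ {V : Type*} (f : V → V → ℝ), (∀ x y, f x y = f y x) → ∀ S : Finset V,
      (∀ x ∈ S, ∀ y ∈ S, f x y ∈ Set.Icc 0 B) → R ≤ #S →
        ∃ T ⊆ S, #T = m ∧
          ∃ D, (T : Set V).Pairwise fun x y ↦ f x y ∈ Set.Icc D (D + η) := by
  set K := ⌊B / η⌋₊ + 1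
  obtain ⟨R, hR⟩ := exists_ramsey_isNClique_labelGraph fun _ : Fin K ↦ m
  refine ⟨R, fun f hf S hfS hS ↦ ?_⟩
  -- Colour the pair `x, y` by the largest multiple of `η` below `f x y`, truncated outside `S`.
  have hK (x y) : ⌊min (f x y) B / η⌋₊ < K :=
    Nat.lt_succ_of_le (Nat.floor_mono (by gcongr; exact min_le_right _ _))
  obtain ⟨a, T, hTS, hT, hTm⟩ :=
    hR (.mk (fun x y _ ↦ ⟨_, hK x y⟩) fun x y _ ↦ by simp only [hf x y]) S hS
  refine ⟨T, hTS, hTm, a * η, fun x hx y hy hxy ↦ ?_⟩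
  obtain ⟨hnonneg, hle⟩ := hfS x (hTS hx) y (hTS hy)
  obtain ⟨_, hcolor⟩ := (SimpleGraph.EdgeLabeling.labelGraph_adj x y).mp (hT hx hy hxy)
  have hfloor : ⌊f x y / η⌋₊ = a := by
    rw [← min_eq_left hle]; exact congrArg Fin.val hcolor
  rw [Nat.floor_eq_iff (by positivity)] at hfloor
  constructor
  · exact (le_div_iff₀ hη).mp hfloor.1
  · linarith [(div_lt_iff₀ hη).mp hfloor.2]

end Ramsey

section PseudoMetricSpace

open Finset

variable {X : Type*} [PseudoMetricSpace X] {T : Finset X} {D : ℝ} {x : X}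

theorem card_sub_one_mul_le_sum_dist_sq (hx : x ∈ T)
    (hD : (T : Set X).Pairwise fun x y ↦ D ≤ dist x y ^ 2) :
    (#T - 1) * D ≤ ∑ y ∈ T, dist x y ^ 2 := by
  classical
  rw [← sum_erase T (a := x) (by simp), ← card_erase_add_one hx, Nat.cast_add_one,
    add_sub_cancel_right, ← nsmul_eq_mul]
  exact card_nsmul_le_sum _ _ _ fun y hy ↦
    hD hx (mem_of_mem_erase hy) (ne_of_mem_erase hy).symm

theorem sum_dist_sq_le_card_sub_one_mul (hx : x ∈ T)
    (hD : (T : Set X).Pairwise fun x y ↦ dist x y ^ 2 ≤ D) :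
    ∑ y ∈ T, dist x y ^ 2 ≤ (#T - 1) * D := by
  classical
  rw [← sum_erase T (a := x) (by simp), ← card_erase_add_one hx, Nat.cast_add_one,
    add_sub_cancel_right, ← nsmul_eq_mul]
  exact sum_le_card_nsmul _ _ _ fun y hy ↦
    hD hx (mem_of_mem_erase hy) (ne_of_mem_erase hy).symm

theorem card_mul_card_sub_one_mul_le_sum_sum_dist_sq
    (hD : (T : Set X).Pairwise fun x y ↦ D ≤ dist x y ^ 2) :
    #T * ((#T - 1) * D) ≤ ∑ x ∈ T, ∑ y ∈ T, dist x y ^ 2 := by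
  rw [← nsmul_eq_mul]
  exact card_nsmul_le_sum _ _ _ fun x hx ↦ card_sub_one_mul_le_sum_dist_sq hx hD

theorem exists_ramsey_pairwise_dist_sq_mem_Icc (m : ℕ) {δ : ℝ} (hδ : 0 < δ) :
    ∃ R : ℕ, ∀ {X : Type*} [PseudoMetricSpace X] {y : X} {ρ : ℝ}, 0 < ρ →
      ∀ S : Finset X, (S : Set X) ⊆ Metric.closedBall y ρ → R ≤ #S →
        ∃ T ⊆ S, #T = m ∧ ∃ D,
          (T : Set X).Pairwise fun x x' ↦ dist x x' ^ 2 ∈ Set.Icc D (D + δ * ρ ^ 2) := by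
  obtain ⟨R, hR⟩ := exists_ramsey_pairwise_mem_Icc m 4 hδ
  refine ⟨R, fun {X _ y ρ} hρ S hSy hS ↦ ?_⟩
  have hdiam : ∀ x ∈ S, ∀ x' ∈ S, (dist x x' / ρ) ^ 2 ∈ Set.Icc 0 4 := fun x hx x' hx' ↦ by
    have hdist : dist x x' ≤ 2 * ρ := by
      linarith [dist_triangle_right x x' y, Metric.mem_closedBall.mp (hSy hx),
        Metric.mem_closedBall.mp (hSy hx')]
    have hsq : (dist x x' / ρ) ^ 2 ≤ 2 ^ 2 := by gcongr; rwa [div_le_iff₀ hρ]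
    exact ⟨by positivity, by linarith⟩
  obtain ⟨T, hTS, hTcard, D, hD⟩ :=
    hR (fun x x' ↦ (dist x x' / ρ) ^ 2) (fun x x' ↦ by rw [dist_comm]) S hdiam hS
  refine ⟨T, hTS, hTcard, D * ρ ^ 2, hD.mono' fun x x' ⟨h, h'⟩ ↦ ?_⟩
  rw [div_pow] at h h'
  exact ⟨(le_div_iff₀ (by positivity)).mp h,
    ((div_le_iff₀ (by positivity)).mp h').trans_eq (by ring)⟩

end PseudoMetricSpace

section InnerProductSpace

open Finset

variable {E : Type*} [SeminormedAddCommGroup E] [InnerProductSpace ℝ E]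

theorem sum_sub_eq_card_smul_centroid_sub {T : Finset E} (hT : T.Nonempty) (y : E) :
    ∑ x ∈ T, (x - y) = (#T : ℝ) • (T.centroid ℝ id - y) := by
  have hcard : (#T : ℝ) ≠ 0 := by exact_mod_cast hT.card_ne_zero
  have hcentroid : T.centroid ℝ id = (#T : ℝ)⁻¹ • ∑ x ∈ T, x := by
    rw [centroid_def, T.affineCombination_eq_linear_combination _ _
      (T.sum_centroidWeights_eq_one_of_nonempty ℝ hT)]
    simp [smul_sum]
  rw [hcentroid, smul_sub, smul_inv_smul₀ hcard, sum_sub_distrib, sum_const,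
    Nat.cast_smul_eq_nsmul]

theorem sum_sum_dist_sq_eq {T : Finset E} (hT : T.Nonempty) (y : E) :
    ∑ x ∈ T, ∑ x' ∈ T, dist x x' ^ 2 =
      2 * #T * (∑ x ∈ T, dist x y ^ 2 - #T * dist y (T.centroid ℝ id) ^ 2) := by
  have hexpand (x x' : E) : dist x x' ^ 2 =
      dist x y ^ 2 + dist x' y ^ 2 - 2 * inner ℝ (x - y) (x' - y) := by
    simp_rw [dist_eq_norm]
    rw [← sub_sub_sub_cancel_right x x' y, norm_sub_sq_real]
    ring
  have hcentroid : ∑ x ∈ T, ∑ x' ∈ T, inner ℝ (x - y) (x' - y) =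
      (#T * dist y (T.centroid ℝ id)) ^ 2 := by
    simp_rw [← inner_sum, ← sum_inner]
    rw [sum_sub_eq_card_smul_centroid_sub hT, real_inner_self_eq_norm_sq, norm_smul,
      Real.norm_natCast, dist_comm, dist_eq_norm]
  rw [sum_congr rfl fun x _ ↦ sum_congr rfl fun x' _ ↦ hexpand x x']
  simp_rw [sum_sub_distrib, sum_add_distrib, ← mul_sum, hcentroid, sum_const,
    nsmul_eq_mul, ← mul_sum]
  ring

theorem card_sub_one_mul_le_of_subset_closedBall {T : Finset E} (hT : T.Nonempty) {y : E}
    {D ρ : ℝ} (hTy : (T : Set E) ⊆ Metric.closedBall y ρ)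
    (hD : (T : Set E).Pairwise fun x x' ↦ D ≤ dist x x' ^ 2) :
    (#T - 1) * D ≤ 2 * #T * ρ ^ 2 := by
  have hcard : (0 : ℝ) < #T := by exact_mod_cast hT.card_pos
  have hball : ∑ x ∈ T, dist x y ^ 2 ≤ #T * ρ ^ 2 := by
    rw [← nsmul_eq_mul]
    refine sum_le_card_nsmul _ _ _ fun x hx ↦ ?_
    gcongr
    exact Metric.mem_closedBall.mp (hTy hx)
  refine le_of_mul_le_mul_left ?_ hcard
  calc #T * ((#T - 1) * D)
      ≤ ∑ x ∈ T, ∑ x' ∈ T, dist x x' ^ 2 := card_mul_card_sub_one_mul_le_sum_sum_dist_sq hD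
    _ = 2 * #T * (∑ x ∈ T, dist x y ^ 2 - #T * dist y (T.centroid ℝ id) ^ 2) :=
        sum_sum_dist_sq_eq hT y
    _ ≤ 2 * #T * (#T * ρ ^ 2) := by gcongr; exact (sub_le_self _ (by positivity)).trans hball
    _ = #T * (2 * #T * ρ ^ 2) := by ring

theorem le_two_mul_one_add_mul_sq_of_subset_closedBall {T : Finset E} {y : E} {D ρ δ : ℝ}
    (hδ : 0 < δ) (hT : 1 ≤ (#T - 1) * δ) (hTy : (T : Set E) ⊆ Metric.closedBall y ρ)
    (hD : (T : Set E).Pairwise fun x x' ↦ D ≤ dist x x' ^ 2) :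
    D ≤ 2 * (1 + δ) * ρ ^ 2 := by
  have hcard : (0 : ℝ) < #T - 1 := pos_of_mul_pos_left (zero_lt_one.trans_le hT) hδ.le
  have hTne : T.Nonempty := card_pos.mp (by exact_mod_cast zero_lt_one.trans (sub_pos.mp hcard))
  refine le_of_mul_le_mul_left ?_ hcard
  calc (#T - 1) * D
      ≤ 2 * #T * ρ ^ 2 := card_sub_one_mul_le_of_subset_closedBall hTne hTy hD
    _ ≤ 2 * ((#T - 1) * (1 + δ)) * ρ ^ 2 := by gcongr; linarith
    _ = (#T - 1) * (2 * (1 + δ) * ρ ^ 2) := by ring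

theorem dist_centroid_sq_le {T : Finset E} {D D' : ℝ}
    (hD : (T : Set E).Pairwise fun x y ↦ dist x y ^ 2 ∈ Set.Icc D D') {x : E} (hx : x ∈ T) :
    dist x (T.centroid ℝ id) ^ 2 ≤ (#T - 1) / #T * (D' - D / 2) := by
  have hcard : (0 : ℝ) < #T := by exact_mod_cast card_pos.mpr ⟨x, hx⟩
  have hlower := card_mul_card_sub_one_mul_le_sum_sum_dist_sq (hD.mono' fun _ _ h ↦ h.1)
  have hupper := sum_dist_sq_le_card_sub_one_mul hx (hD.mono' fun _ _ h ↦ h.2)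
  rw [sum_sum_dist_sq_eq ⟨x, hx⟩ x] at hlower
  simp_rw [dist_comm _ x] at hlower
  have hmean : (#T - 1) * D ≤ 2 * (∑ y ∈ T, dist x y ^ 2 - #T * dist x (T.centroid ℝ id) ^ 2) :=
    le_of_mul_le_mul_left (hlower.trans_eq (by ring)) hcard
  rw [div_mul_eq_mul_div, le_div_iff₀' hcard]
  linarith

theorem exists_ramsey_dist_sq_le (L : ℕ) {t : ℝ} (ht : (L - 1) / L < t) :
    ∃ M : ℕ, ∀ {E : Type*} [SeminormedAddCommGroup E] [InnerProductSpace ℝ E] {y : E} {ρ : ℝ},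
      0 < ρ → ∀ S : Finset E, (S : Set E) ⊆ Metric.closedBall y ρ → M ≤ #S →
        ∃ T ⊆ S, #T = L ∧ ∃ z, ∀ x ∈ T, dist x z ^ 2 ≤ t * ρ ^ 2 := by
  obtain ⟨δ, hδ, rfl⟩ : ∃ δ > 0, t = (L - 1) / L + 2 * δ :=
    ⟨(t - (L - 1) / L) / 2, by linarith, by ring⟩
  obtain ⟨m, hm⟩ := exists_nat_gt (1 / δ)
  obtain ⟨M, hM⟩ := exists_ramsey_pairwise_dist_sq_mem_Icc (m + L + 1) hδ
  refine ⟨M, fun {E _ _ y ρ} hρ S hSy hS ↦ ?_⟩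
  obtain ⟨T, hTS, hTcard, D, hD⟩ := hM hρ S hSy hS
  have hD_le : D ≤ 2 * (1 + δ) * ρ ^ 2 := by
    refine le_two_mul_one_add_mul_sq_of_subset_closedBall hδ ?_
      ((coe_subset.mpr hTS).trans hSy) (hD.mono' fun _ _ h ↦ h.1)
    rw [← div_le_iff₀ hδ, hTcard]
    push_cast
    linarith
  obtain ⟨U, hUT, rfl⟩ := exists_subset_card_eq (show L ≤ #T by lia)
  refine ⟨U, hUT.trans hTS, rfl, U.centroid ℝ id, fun x hx ↦ ?_⟩
  have hU : (1 : ℝ) ≤ #U := by exact_mod_cast card_pos.mpr ⟨x, hx⟩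
  have hratio_nonneg : 0 ≤ ((#U - 1) / #U : ℝ) := div_nonneg (by linarith) (by linarith)
  have hratio_le : ((#U - 1) / #U : ℝ) ≤ 1 := div_le_one_of_le₀ (by linarith) (by linarith)
  calc dist x (U.centroid ℝ id) ^ 2
      ≤ (#U - 1) / #U * (D + δ * ρ ^ 2 - D / 2) :=
        dist_centroid_sq_le (hD.mono (coe_subset.mpr hUT)) hx
    _ ≤ (#U - 1) / #U * ((1 + 2 * δ) * ρ ^ 2) :=
        mul_le_mul_of_nonneg_left (by linarith) hratio_nonneg
    _ = ((#U - 1) / #U + (#U - 1) / #U * (2 * δ)) * ρ ^ 2 := by ring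
    _ ≤ ((#U - 1) / #U + 2 * δ) * ρ ^ 2 := by
        have hδ_le := mul_le_of_le_one_left (by positivity : 0 ≤ 2 * δ) hratio_le
        exact mul_le_mul_of_nonneg_right (by linarith) (sq_nonneg ρ)

end InnerProductSpace

section Averaging

open Metric

theorem tsum_measure_closedBall_le {X : Type*} [PseudoMetricSpace X] [MeasurableSpace X]
    [OpensMeasurableSpace X] (μ : Measure X) {S W : Set X} {ρ : ℝ} {k : ℕ} (hSW : S ⊆ W)
    (hS : ∀ y, (S ∩ closedBall y ρ).encard ≤ k) :
    ∑' x : S, μ (closedBall (x : X) ρ) ≤ k * μ (cthickening ρ W) := by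
  classical
  rw [ENNReal.tsum_eq_iSup_sum]
  refine iSup_le fun T ↦ ?_
  have hcount (y : X) : ∑ x ∈ T, (closedBall (x : X) ρ).indicator 1 y ≤
      (cthickening ρ W).indicator (fun _ ↦ (k : ℝ≥0∞)) y := by
    by_cases hy : y ∈ cthickening ρ W
    · have hsub : (↑) '' (({x ∈ T | y ∈ closedBall (x : X) ρ} : Finset S) : Set S) ⊆
          S ∩ closedBall y ρ := by
        rintro _ ⟨x, hx, rfl⟩
        exact ⟨x.2, mem_closedBall_comm.mp (Finset.mem_filter.mp hx).2⟩
      have hcard := (Set.encard_le_encard hsub).trans (hS y)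
      rw [Subtype.val_injective.encard_image, Set.encard_coe_eq_coe_finsetCard,
        Nat.cast_le] at hcard
      simp only [Set.indicator_apply, Pi.one_apply, Finset.sum_boole, hy, if_true]
      exact_mod_cast hcard
    · rw [Set.indicator_of_notMem hy, Finset.sum_eq_zero fun x _ ↦
        Set.indicator_of_notMem (fun hxy ↦ hy (closedBall_subset_cthickening (hSW x.2) ρ hxy)) _]
  calc ∑ x ∈ T, μ (closedBall (x : X) ρ)
      = ∑ x ∈ T, ∫⁻ y, (closedBall (x : X) ρ).indicator 1 y ∂μ :=
        Finset.sum_congr rfl fun x _ ↦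
          (lintegral_indicator_one isClosed_closedBall.measurableSet).symm
    _ = ∫⁻ y, ∑ x ∈ T, (closedBall (x : X) ρ).indicator 1 y ∂μ :=
        (lintegral_finsetSum _ fun x _ ↦
          measurable_one.indicator isClosed_closedBall.measurableSet).symm
    _ ≤ ∫⁻ y, (cthickening ρ W).indicator (fun _ ↦ (k : ℝ≥0∞)) y ∂μ := lintegral_mono hcount
    _ = k * μ (cthickening ρ W) :=
        lintegral_indicator_const isClosed_cthickening.measurableSet _

theorem encard_mul_measure_closedBall_le {E : Type*} [SeminormedAddCommGroup E] [MeasurableSpace E]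
    [BorelSpace E] (μ : Measure E) [μ.IsAddLeftInvariant] {S W : Set E} {ρ : ℝ} {k : ℕ}
    (hSW : S ⊆ W) (hS : ∀ y, (S ∩ closedBall y ρ).encard ≤ k) :
    S.encard * μ (closedBall 0 ρ) ≤ k * μ (cthickening ρ W) := by
  have h := tsum_measure_closedBall_le μ hSW hS
  have hcenter (x : E) : μ (closedBall x ρ) = μ (closedBall 0 ρ) := by
    rw [← measure_preimage_add μ x]
    simp
  simpa only [hcenter, ENNReal.tsum_set_const] using h

end Averaging

section Window

open Metric Topology

variable {E : Type*} [NormedAddCommGroup E] [NormedSpace ℝ E] {A : Set E}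

theorem cthickening_smul_of_isCompact (hA : IsCompact A) {K ρ : ℝ} (hK : 0 < K) (hρ : 0 ≤ ρ) :
    cthickening ρ (K • A) = K • cthickening (ρ / K) A := by
  rw [← (hA.smul K).add_closedBall_zero hρ, ← hA.add_closedBall_zero (by positivity), smul_add,
    _root_.smul_closedBall _ _ (by positivity), smul_zero, Real.norm_of_nonneg hK.le,
    mul_div_cancel₀ _ hK.ne']

variable [FiniteDimensional ℝ E] [MeasurableSpace E] [BorelSpace E] (μ : Measure E)
  [μ.IsAddHaarMeasure]

theorem tendsto_measure_cthickening_smul_div (hA : IsCompact A) (hA0 : μ A ≠ 0) {ρ : ℝ}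
    (hρ : 0 ≤ ρ) :
    Tendsto (fun K : ℝ ↦ μ (cthickening ρ (K • A)) / μ (K • A)) atTop (𝓝 1) := by
  have hlim : Tendsto (fun K : ℝ ↦ μ (cthickening (ρ / K) A) / μ A) atTop (𝓝 1) := by
    rw [← ENNReal.div_self hA0 hA.measure_lt_top.ne]
    exact ENNReal.Tendsto.div_const
      ((tendsto_measure_cthickening_of_isCompact hA).comp
        (tendsto_const_nhds.div_atTop tendsto_id)) (.inr hA0)
  refine hlim.congr' ?_
  filter_upwards [eventually_gt_atTop 0] with K hK
  rw [cthickening_smul_of_isCompact hA hK hρ, Measure.addHaar_smul, Measure.addHaar_smul,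
    ENNReal.mul_div_mul_left _ _ (by simp [hK.ne']) ENNReal.ofReal_ne_top]

end Window

section BallVolume

open Real Topology

theorem tendsto_log_factorial_div_sub_log :
    Tendsto (fun n : ℕ ↦ log n.factorial / n - log n) atTop (𝓝 (-1)) := by
  have hstirling : Tendsto (fun n : ℕ ↦ log (Stirling.stirlingSeq n) / n) atTop (𝓝 0) :=
    (Stirling.tendsto_stirlingSeq_sqrt_pi.log (by positivity)).div_atTop
      tendsto_natCast_atTop_atTop
  have hlog : Tendsto (fun n : ℕ ↦ log n / n) atTop (𝓝 0) :=
    isLittleO_log_id_atTop.tendsto_div_nhds_zero.comp tendsto_natCast_atTop_atTop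
  have hlim := ((hstirling.add (hlog.const_mul (1 / 2))).add
    ((tendsto_const_div_atTop_nhds_zero_nat (log 2)).const_mul (1 / 2))).sub_const 1
  simp only [mul_zero, add_zero, zero_sub] at hlim
  refine hlim.congr' ?_
  filter_upwards [eventually_gt_atTop 0] with n hn
  have hn' : (0 : ℝ) < n := by exact_mod_cast hn
  rw [Stirling.log_stirlingSeq_formula, log_mul two_ne_zero hn'.ne',
    log_div hn'.ne' (exp_pos 1).ne', log_exp]
  field_simp
  ring

theorem Gamma_half_add_half_mul_Gamma_half_add_one (n : ℕ) :
    Gamma ((n + 1) / 2) * Gamma (n / 2 + 1) = n.factorial * √π / 2 ^ n := by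
  have h := Gamma_mul_Gamma_add_half ((n + 1) / 2 : ℝ)
  rw [show ((n + 1) / 2 + 1 / 2 : ℝ) = n / 2 + 1 by ring, mul_div_cancel₀ _ two_ne_zero,
    Gamma_nat_eq_factorial, show (1 - (n + 1) : ℝ) = -n by ring, rpow_neg two_pos.le,
    rpow_natCast] at h
  rw [h]
  ring

theorem factorial_mul_sqrt_pi_div_le_sq_Gamma_half_add_one {n : ℕ} (hn : 3 ≤ n) :
    n.factorial * √π / 2 ^ n ≤ Gamma (n / 2 + 1) ^ 2 := by
  have hn' : (3 : ℝ) ≤ n := by exact_mod_cast hn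
  rw [← Gamma_half_add_half_mul_Gamma_half_add_one, sq]
  refine mul_le_mul_of_nonneg_right ?_ (Gamma_nonneg_of_nonneg (by positivity))
  exact Gamma_strictMonoOn_Ici.monotoneOn (Set.mem_Ici.mpr (by linarith))
    (Set.mem_Ici.mpr (by linarith)) (by linarith)

theorem sq_Gamma_half_add_one_le {n : ℕ} (hn : 2 ≤ n) :
    Gamma (n / 2 + 1) ^ 2 ≤ n * (n.factorial * √π / 2 ^ n) := by
  have hn' : (2 : ℝ) ≤ n := by exact_mod_cast hn
  have : 0 < Gamma ((n + 1) / 2 : ℝ) := Gamma_pos_of_pos (by positivity)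
  rw [← Gamma_half_add_half_mul_Gamma_half_add_one, sq, ← mul_assoc]
  refine mul_le_mul_of_nonneg_right ?_ (Gamma_nonneg_of_nonneg (by positivity))
  calc Gamma (n / 2 + 1 : ℝ)
      ≤ Gamma ((n + 1) / 2 + 1) :=
        Gamma_strictMonoOn_Ici.monotoneOn (Set.mem_Ici.mpr (by linarith))
          (Set.mem_Ici.mpr (by linarith)) (by linarith)
    _ = (n + 1) / 2 * Gamma ((n + 1) / 2) := Gamma_add_one (by positivity)
    _ ≤ n * Gamma ((n + 1) / 2) := by gcongr; linarith

theorem tendsto_log_Gamma_half_add_one_div_sub_log :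
    Tendsto (fun n : ℕ ↦ log (Gamma (n / 2 + 1)) / n - log n / 2) atTop
      (𝓝 (-(1 + log 2) / 2)) := by
  have hlower : Tendsto (fun n : ℕ ↦ log (n.factorial * √π / 2 ^ n) / (2 * n) - log n / 2) atTop
      (𝓝 (-(1 + log 2) / 2)) := by
    have hlim := ((tendsto_log_factorial_div_sub_log.add
      (tendsto_const_div_atTop_nhds_zero_nat (log √π))).sub_const (log 2)).const_mul (1 / 2)
    refine (hlim.congr' ?_).trans_eq (by ring_nf)
    filter_upwards [eventually_gt_atTop 0] with n hn
    rw [log_div (by positivity) (by positivity), log_mul (by positivity) (by positivity), log_pow]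
    field_simp
    ring
  have hupper : Tendsto (fun n : ℕ ↦ log (n * (n.factorial * √π / 2 ^ n)) / (2 * n) - log n / 2)
      atTop (𝓝 (-(1 + log 2) / 2)) := by
    have hlog : Tendsto (fun n : ℕ ↦ log n / n) atTop (𝓝 0) :=
      isLittleO_log_id_atTop.tendsto_div_nhds_zero.comp tendsto_natCast_atTop_atTop
    refine ((hlower.add (hlog.const_mul (1 / 2))).congr' ?_).trans_eq (by simp)
    filter_upwards [eventually_gt_atTop 0] with n hn
    rw [log_mul (x := (n : ℝ)) (by positivity) (by positivity)]
    field_simp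
    ring
  have hsq (n : ℕ) : log (Gamma (n / 2 + 1)) / n = log (Gamma (n / 2 + 1) ^ 2) / (2 * n) := by
    rw [log_pow, Nat.cast_two, mul_div_mul_left _ _ two_ne_zero]
  simp_rw [hsq]
  refine tendsto_of_tendsto_of_tendsto_of_le_of_le' hlower hupper ?_ ?_
  · filter_upwards [eventually_ge_atTop 3] with n hn
    gcongr
    exact factorial_mul_sqrt_pi_div_le_sq_Gamma_half_add_one hn
  · filter_upwards [eventually_ge_atTop 2] with n hn
    have := Gamma_pos_of_pos (by positivity : (0 : ℝ) < n / 2 + 1)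
    gcongr
    exact sq_Gamma_half_add_one_le hn

theorem tendsto_log_volume_real_closedBall_div {N : ℝ} (hN : 0 < N) :
    Tendsto (fun n : ℕ ↦
      log (volume.real (Metric.closedBall (0 : EuclideanSpace ℝ (Fin n)) √(n * N))) / n) atTop
      (𝓝 (1 / 2 * log (2 * π * exp 1 * N))) := by
  have hlim := (tendsto_log_Gamma_half_add_one_div_sub_log.neg.add_const ((log N + log π) / 2))
  have hlog : log (2 * π * exp 1 * N) = log 2 + log π + 1 + log N := by
    rw [log_mul (by positivity) hN.ne', log_mul (by positivity) (by positivity),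
      log_mul (by positivity) (by positivity), log_exp]
  rw [hlog]
  refine (hlim.congr' ?_).trans_eq (by ring_nf)
  filter_upwards [eventually_gt_atTop 0] with n hn
  have : Nonempty (Fin n) := ⟨⟨0, hn⟩⟩
  have hΓ : 0 < Gamma (n / 2 + 1 : ℝ) := Gamma_pos_of_pos (by positivity)
  rw [Measure.real, EuclideanSpace.volume_closedBall, Fintype.card_fin, ENNReal.toReal_mul,
    ENNReal.toReal_pow, ENNReal.toReal_ofReal (by positivity),
    ENNReal.toReal_ofReal (by positivity), log_mul (by positivity) (by positivity),
    log_div (by positivity) hΓ.ne', log_pow, log_pow, log_sqrt (by positivity),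
    log_sqrt pi_pos.le, log_mul (by positivity) hN.ne']
  field_simp
  ring

end BallVolume

section Capacity

open Metric Real Topology

theorem packingRate_le {n : ℕ} {A C : Set (EuclideanSpace ℝ (Fin n))} (hA : IsCompact A)
    (hA0 : volume A ≠ 0) {ρ : ℝ} (hρ : 0 < ρ) {k : ℕ}
    (hC : ∀ y, (C ∩ closedBall y ρ).encard ≤ k) :
    packingRate A C ≤ ENNReal.log
      (k / volume (closedBall (0 : EuclideanSpace ℝ (Fin n)) ρ)) / (n : EReal) := by
  set V := volume (closedBall (0 : EuclideanSpace ℝ (Fin n)) ρ)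
  have hV : V ≠ 0 := (measure_closedBall_pos volume _ hρ).ne'
  have hV' : V ≠ ∞ := measure_closedBall_lt_top.ne
  have hlim : Tendsto (fun K : ℝ ↦ ENNReal.log
      (k / V * (volume (cthickening ρ (K • A)) / volume (K • A))) / (n : EReal)) atTop
      (𝓝 (ENNReal.log (k / V) / (n : EReal))) := by
    have hratio := ENNReal.Tendsto.const_mul (a := k / V)
      (tendsto_measure_cthickening_smul_div volume hA hA0 hρ.le) (.inl one_ne_zero)
    rw [mul_one] at hratio
    have hn : ((n : EReal))⁻¹ = ((n : ℝ)⁻¹ : ℝ) := by norm_cast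
    exact EReal.Tendsto.mul_const ((ENNReal.continuous_log.tendsto _).comp hratio)
      (.inr (hn ▸ EReal.coe_ne_bot _)) (.inr (hn ▸ EReal.coe_ne_top _))
  refine (limsup_le_limsup ?_).trans_eq hlim.limsup_eq
  refine .of_forall fun K ↦ EReal.div_le_div_right_of_nonneg (by positivity) <|
    ENNReal.log_monotone ?_
  have hcount : (C ∩ K • A).encard * V ≤ k * volume (cthickening ρ (K • A)) :=
    encard_mul_measure_closedBall_le volume Set.inter_subset_right fun y ↦
      (Set.encard_le_encard (Set.inter_subset_inter_left _ Set.inter_subset_left)).trans (hC y)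
  rw [← mul_div_assoc, ENNReal.mul_comm_div]
  gcongr
  rwa [mul_div_assoc', ENNReal.le_div_iff_mul_le (.inl hV) (.inl hV')]

theorem ennrealLog_div_eq_coe {a b : ℝ≥0∞} (ha : a ≠ 0) (ha' : a ≠ ∞) (hb : b ≠ 0)
    (hb' : b ≠ ∞) : ENNReal.log (a / b) = (log a.toReal - log b.toReal : ℝ) := by
  have ha_pos := ENNReal.toReal_pos ha ha'
  have hb_pos := ENNReal.toReal_pos hb hb'
  have hratio : (a / b).toReal = a.toReal / b.toReal := ENNReal.toReal_div a b
  rw [ENNReal.log_pos_real' (hratio ▸ div_pos ha_pos hb_pos), hratio,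
    log_div ha_pos.ne' hb_pos.ne']

theorem listDecodingCapacity_le {A : ∀ n : ℕ, Set (EuclideanSpace ℝ (Fin n))}
    (hA : ∀ n, IsCompact (A n)) (hA0 : ∀ n, volume (A n) ≠ 0) {N : ℝ} (hN : 0 < N) {L : ℕ}
    (hL : 2 ≤ L) :
    listDecodingCapacity A N L ≤ ((-(1 / 2 * log (2 * π * exp 1 * N)) : ℝ) : EReal) := by
  have hlim : Tendsto (fun n : ℕ ↦ log (L - 1 : ℕ) / n -
      log (volume.real (closedBall (0 : EuclideanSpace ℝ (Fin n)) √(n * N))) / n) atTop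
      (𝓝 (-(1 / 2 * log (2 * π * exp 1 * N)))) := by
    simpa using (tendsto_const_div_atTop_nhds_zero_nat _).sub
      (tendsto_log_volume_real_closedBall_div hN)
  refine (limsup_le_limsup ?_).trans_eq
    ((continuous_coe_real_ereal.tendsto _).comp hlim).limsup_eq
  filter_upwards [eventually_gt_atTop 0] with n hn
  have hρ : 0 < √(n * N) := by positivity
  refine iSup₂_le fun C hC ↦ (packingRate_le (hA n) (hA0 n) hρ hC).trans_eq ?_
  rw [ennrealLog_div_eq_coe (by exact_mod_cast (by lia : L - 1 ≠ 0)) (ENNReal.natCast_ne_top _)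
    (measure_closedBall_pos volume _ hρ).ne' measure_closedBall_lt_top.ne,
    ENNReal.toReal_natCast, Function.comp_apply, ← sub_div, EReal.coe_div,
    EReal.coe_coe_eq_natCast, Measure.real]

theorem IsMultiplePacking.exists_of_mul_lt {N N' : ℝ} {L : ℕ} (hL : L ≠ 0) (hN' : 0 < N')
    (h : (L - 1) / L * N' < N) :
    ∃ M ≥ 2, ∀ {n : ℕ}, n ≠ 0 → ∀ {C : Set (EuclideanSpace ℝ (Fin n))},
      IsMultiplePacking N L C → IsMultiplePacking N' M C := by
  obtain ⟨M, hM⟩ := exists_ramsey_dist_sq_le L ((lt_div_iff₀ hN').mpr h)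
  refine ⟨M + 2, by lia, fun {n} hn {C} hC y ↦ ?_⟩
  have : (0 : ℝ) < n := by positivity
  by_contra! hlt
  obtain ⟨S, hSC, hS⟩ := Set.exists_subset_encard_eq hlt.le
  lift S to Finset (EuclideanSpace ℝ (Fin n)) using Set.finite_of_encard_eq_coe hS
  rw [Set.encard_coe_eq_coe_finsetCard, Nat.cast_inj] at hS
  obtain ⟨T, hTS, hT, z, hz⟩ := hM (by positivity : 0 < √(n * N')) S
    (hSC.trans Set.inter_subset_right) (by lia)
  have hTz : (T : Set (EuclideanSpace ℝ (Fin n))) ⊆ C ∩ closedBall z √(n * N) :=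
    fun x hx ↦ ⟨(hSC (hTS hx)).1, le_sqrt_of_sq_le <| (hz x hx).trans_eq <| by
      rw [sq_sqrt (by positivity)]; field_simp⟩
  have hcard := (Set.encard_le_encard hTz).trans (hC z)
  rw [Set.encard_coe_eq_coe_finsetCard, hT, Nat.cast_le] at hcard
  lia

theorem listDecodingCapacity_le_listDecodingCapacity
    (A : ∀ n : ℕ, Set (EuclideanSpace ℝ (Fin n))) {N N' : ℝ} {L : ℕ} (hL : L ≠ 0) (hN' : 0 < N')
    (h : (L - 1) / L * N' < N) :
    ∃ M ≥ 2, listDecodingCapacity A N L ≤ listDecodingCapacity A N' M := by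
  obtain ⟨M, hM, hC⟩ := IsMultiplePacking.exists_of_mul_lt hL hN' h
  refine ⟨M, hM, limsup_le_limsup ?_⟩
  filter_upwards [eventually_ne_atTop 0] with n hn
  exact iSup₂_mono' fun C hCN ↦ ⟨C, hC hn hCN, le_rfl⟩

theorem mainTheorem6_general (N : ℝ) (hN : 0 < N) (L : ℕ) (hL : 2 ≤ L)
    (A : ∀ n : ℕ, Set (EuclideanSpace ℝ (Fin n))) (hA : ∀ n, IsCompact (A n))
    (hA0 : ∀ n, volume (A n) ≠ 0) :
    listDecodingCapacity A N L ≤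
      ((1 / 2 * log (((L : ℝ) - 1) / (L * (2 * π * exp 1 * N))) : ℝ) : EReal) := by
  have hL' : (0 : ℝ) < L - 1 := sub_pos.mpr (by exact_mod_cast hL)
  set N₀ := N * L / (L - 1)
  have hN₀ : 0 < N₀ := by positivity
  have hlog : 1 / 2 * log ((L - 1) / (L * (2 * π * exp 1 * N))) =
      -(1 / 2 * log (2 * π * exp 1 * N₀)) := by
    rw [← mul_neg, ← log_inv]
    congr 2
    simp only [N₀]
    field_simp
  have hcont : ContinuousAt (fun N' ↦ ((-(1 / 2 * log (2 * π * exp 1 * N')) : ℝ) : EReal)) N₀ :=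
    continuous_coe_real_ereal.continuousAt.comp <| by fun_prop (disch := positivity)
  rw [hlog]
  refine ge_of_tendsto (hcont.tendsto.mono_left (nhdsWithin_le_nhds (s := Set.Iio N₀))) ?_
  filter_upwards [Ioo_mem_nhdsLT hN₀] with N' hN'
  have hlt : (L - 1) / L * N' < N := by
    rw [div_mul_eq_mul_div, div_lt_iff₀ (by positivity), mul_comm]
    exact (lt_div_iff₀ hL').mp hN'.2
  obtain ⟨M, hM, hle⟩ := listDecodingCapacity_le_listDecodingCapacity A (by lia) hN'.1 hlt
  exact hle.trans (listDecodingCapacity_le hA hA0 hN'.1 hM)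

end Capacity

theorem mainTheorem6 (N : ℝ) (hN : 0 < N) (L : ℕ) (hL : 2 ≤ L)
    (A : ∀ n : ℕ, Set (EuclideanSpace ℝ (Fin n))) (hA : ∀ n : ℕ, IsWindow (A n)) :
    listDecodingCapacity A N L ≤
      ((1 / 2 * Real.log (((L : ℝ) - 1) / (L * (2 * Real.pi * Real.exp 1 * N))) : ℝ) : EReal) :=
  mainTheorem6_general N hN L hL A (fun n ↦ (hA n).compact) fun n ↦
    (Measure.measure_pos_of_nonempty_interior volume (hA n).interior_nonempty).ne'
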